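/- **Setting.** There are $K\ge 1$ arms with unknown mean rewards $\mu_1,\dots,\mu_K\in[0,\infty)$ and $T$ periods. In each period $t$ one unit of resource is divided among the arms, $A_{ti}\ge 0$, $\sum_i A_{ti}=1$, as a function of the past allocations and rewards, and the rewards $Y_{ti}=A_{ti}\mu_i+A_{ti}^{\,b}\,\xi_{ti}$ are observed. The noises $\xi_{ti}$ ($1\le t\le T$, $1\le i\le K$) are independent and $\sigma$-sub-Gaussian, i.e. $E[e^{\lambda\xi_{ti}}]\le e^{\lambda^2\sigma^2/2}$ for all $\lambda\in\mathbb R$, with $\sigma>0$; they need not be identically distributed. The regret is $R(T)=\sum_{t=1}^T E\bigl[\max_j\mu_j-\sum_i A_{ti}\mu_i\bigr]$, and $\Delta_{\max}=\max_i(\max_j\mu_j-\mu_i)$. **Algorithm** (successive elimination with divisible resources; input $b,\sigma,T$). Start with the active set $D=\{1,\dots,K\}$. In each period $t=1,\dots,T$ allocate $1/|D|$ to each arm of $D$ and nothing to the others. At the end of each period $t\ge 2$ compute for $i\in D$ $$\hat\mu_{ti}=\frac{\sum_{s\le t}Y_{si}}{\sum_{s\le t}A_{si}},\qquad R_{ti}=\frac{\bigl(\sum_{s\le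 t}A_{si}\bigr)^2}{\sum_{s\le t}A_{si}^{2b}},\qquad CI(t,i)=\frac{2\sqrt3\,\sigma\sqrt{\log t\,\log T}}{\sqrt{R_{ti}}},$$ and remove from $D$ all arms $i\in D$ with $\hat\mu_{ti}+CI(t,i)<\max_{j\in D}\bigl(\hat\mu_{tj}-CI(t,j)\bigr)$. (No arm is removed at the end of period $1$.) **Theorem.** For every $b\in[1/2,1)$ there is a constant $C>0$, depending only on $b$, such that for all $1\le K\le T$, all $\sigma>0$, all mean rewards and all noise distributions as above, the regret of the algorithm satisfies $$R(T)\le C\left(\Delta_{\max}+\sigma K^{1-b}\sqrt T\,\log T\right).$$ In particular, if the gaps $\Delta_{\max}$ and $\sigma$ are bounded, the regret is $O(K^{1-b}\sqrt T\log T)$ uniformly over all instances. -/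

import Mathlib

open MeasureTheory ProbabilityTheory
open scoped NNReal

/-- What the decision maker records in one period: the amount of resource given to each of the
`K` arms, and the reward of each arm. -/
structure Round (K : ℕ) where
  alloc : Fin K → ℝ
  reward : Fin K → ℝ

/-- The rounds played so far, the most recent one first; a history of length `t` is what is known
after `t` periods. -/
abbrev History (K : ℕ) := List (Round K)

/-- A policy maps the past history to the allocation of the next period. -/
abbrev Policy (K : ℕ) := History K → Fin K → ℝ

/-- The history after `t` periods when policy `π` is played against the mean rewards `μ` and the
noise path `x`, where `x s i` is the noise of arm `i` in period `s ≥ 1`. The reward of arm `i` under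
allocation `a` is `a * μ i + a ^ b * (noise)`. -/
noncomputable def play {K : ℕ} (b : ℝ) (μ : Fin K → ℝ) (π : Policy K) (x : ℕ → Fin K → ℝ) :
    ℕ → History K
  | 0 => []
  | t + 1 =>
    { alloc := π (play b μ π x t)
      reward := fun i =>
        π (play b μ π x t) i * μ i + π (play b μ π x t) i ^ b * x (t + 1) i } ::
      play b μ π x t

/-- The regret of policy `π` over `T` periods:
`∑_{t = 1}^T E[max_i μ_i - ∑_i A_{ti} μ_i]`. The allocation of period `t + 1` is the value of the
policy at the history of the first `t` periods. -/
noncomputable def regret {K : ℕ} {Ω : Type*} [MeasurableSpace Ω] (P : Measure Ω) (b : ℝ)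
    (μ : Fin K → ℝ) (ξ : ℕ → Fin K → Ω → ℝ) (π : Policy K) (T : ℕ) : ℝ :=
  ∑ t ∈ Finset.range T,
    ∫ ω, ((⨆ j, μ j) - ∑ i, π (play b μ π (fun s k => ξ s k ω) t) i * μ i) ∂P

/-- The largest suboptimality gap `Δ_max = max_i (max_j μ_j - μ_i)`. -/
noncomputable def gapMax {K : ℕ} (μ : Fin K → ℝ) : ℝ := ⨆ i, ((⨆ j, μ j) - μ i)

namespace SuccElim

/-- The total resource `∑_s A_{si}` received by arm `i`. -/
def pulls {K : ℕ} (h : History K) (i : Fin K) : ℝ := (h.map fun r => r.alloc i).sum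

/-- The mean estimator `(∑_s Y_{si}) / (∑_s A_{si})`. -/
noncomputable def meanEst {K : ℕ} (h : History K) (i : Fin K) : ℝ :=
  (h.map fun r => r.reward i).sum / pulls h i

/-- `R_{ti} = (∑_s A_{si})² / ∑_s A_{si}^{2b}`. -/
noncomputable def precision {K : ℕ} (b : ℝ) (h : History K) (i : Fin K) : ℝ :=
  pulls h i ^ 2 / (h.map fun r => r.alloc i ^ (2 * b)).sum

/-- The half-width `2 √3 σ √(log t log T) / √R_{ti}` of the confidence interval, where `t` is the
length of the history. -/
noncomputable def ci {K : ℕ} (b σ : ℝ) (T : ℕ) (h : History K) (i : Fin K) : ℝ :=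
  2 * √3 * σ * √(Real.log h.length * Real.log T) / √(precision b h i)

noncomputable def ucb {K : ℕ} (b σ : ℝ) (T : ℕ) (h : History K) (i : Fin K) : ℝ :=
  meanEst h i + ci b σ T h i

noncomputable def lcb {K : ℕ} (b σ : ℝ) (T : ℕ) (h : History K) (i : Fin K) : ℝ :=
  meanEst h i - ci b σ T h i

open Classical in
/-- The active set after the periods recorded in the history. All arms are active at first. After
each period `t ≥ 2`, those active arms `i` are removed whose upper confidence bound is less than the
maximal lower confidence bound of the active arms, that is, less than the lower confidence bound
of some active arm. After period `1`, where `log t = 0` and the intervals have zero width, no arm is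
removed. -/
noncomputable def active {K : ℕ} (b σ : ℝ) (T : ℕ) : History K → Finset (Fin K)
  | [] => Finset.univ
  | r :: h =>
    if 2 ≤ (r :: h).length then
      (active b σ T h).filter fun i =>
        ¬ ∃ j ∈ active b σ T h, ucb b σ T (r :: h) i < lcb b σ T (r :: h) j
    else active b σ T h

open Classical in
/-- Successive elimination with divisible resources: the unit resource is split evenly among the
active arms. -/
noncomputable def policy (K : ℕ) (b σ : ℝ) (T : ℕ) : Policy K := fun h i =>
  if i ∈ active b σ T h then 1 / ((active b σ T h).card : ℝ) else 0

end SuccElim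

/-! The regret is charged arm by arm. While the estimates stay within their confidence widths, an
optimal arm survives, and an arm that is still active after `t` periods has gap at most a constant
times `σ log T · √Q / N`. Here `N` is the resource that the arm has received and `Q` is the sum of
the powers `2b` of its allocations. Apply this at the last time when the arm is active, with `k`
arms left. The arm's regret up to then is at most gap times `N`, hence of order `σ log T · √Q`. As
the active sets shrink, every earlier allocation was at most `1/k`, so `√Q ≤ √T k^(-b)`. Ordering
the arms by elimination time bounds the sum of `k^(-b)` by `∑ m^(-b)` over `m ≤ K`, which is of
order `K^(1-b)` (`sum_avg_gap_le`).

The estimates need a self-normalized bound, because `Q` depends on the past noise. For a fixed tilt,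
the exponential of the tilted noise minus its variance term is a supermartingale
(`lintegral_exp_logMart_le_one`). The best tilt depends on the random `√Q`, which lies in `[√t/K,
√t]`, so a geometric grid of `O(K)` tilts suffices. A union bound over periods, arms, grid points
and signs leaves a bad event of probability at most `8/T`, on which the trivial regret `T Δ_max` is
affordable. -/

/-! ### Regret of a nested elimination scheme (deterministic) -/

/-- If every nonempty subfamily `S'` of `S` has a member whose rank is at least `#S'`, then the sum
of an antitone function of the ranks is at most the sum over the ranks `1, …, #S`. -/
theorem sum_comp_rank_le {ι : Type*} [DecidableEq ι] {f : ℕ → ℝ}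
    (hf : ∀ m n, 1 ≤ m → m ≤ n → f n ≤ f m) (k : ι → ℕ) (n : ℕ) :
    ∀ S : Finset ι, S.card = n →
      (∀ S' ⊆ S, S'.Nonempty → ∃ i ∈ S', S'.card ≤ k i) →
      ∑ i ∈ S, f (k i) ≤ ∑ m ∈ Finset.range n, f (m + 1) := by
  induction n with
  | zero =>
    intro S hS _
    simp [Finset.card_eq_zero.mp hS]
  | succ n ih =>
    intro S hS h
    have hne : S.Nonempty := Finset.card_pos.mp (by omega)
    -- The member whose rank is at least `#S` pays for the last, smallest term; the hypothesis
    -- passes to the remaining members.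
    obtain ⟨i, hi, hk⟩ := h S subset_rfl hne
    rw [← Finset.sum_erase_add S _ hi, Finset.sum_range_succ]
    refine add_le_add (ih _ ?_ ?_) (hf _ _ (by omega) (by omega))
    · rw [Finset.card_erase_of_mem hi]; omega
    · exact fun S' hS' => h S' (hS'.trans (Finset.erase_subset _ _))

theorem sum_rpow_neg_le {b : ℝ} (hb : 0 ≤ b) (hb1 : b < 1) (K : ℕ) :
    ∑ n ∈ Finset.range K, ((n + 1 : ℕ) : ℝ) ^ (-b) ≤ (K : ℝ) ^ (1 - b) / (1 - b) := by
  have h1 : 0 < 1 - b := by linarith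
  induction K with
  | zero => simp [Real.zero_rpow h1.ne']
  | succ K ih =>
    rw [Finset.sum_range_succ]
    set x : ℝ := ((K + 1 : ℕ) : ℝ) with hx
    have hx0 : 0 < x := by positivity
    have hx1 : 1 ≤ x := by rw [hx]; push_cast; linarith [Nat.cast_nonneg (α := ℝ) K]
    have hK : (K : ℝ) = x * (1 + -x⁻¹) := by rw [hx]; push_cast; field_simp; ring
    have hinv : x⁻¹ ≤ 1 := inv_le_one_of_one_le₀ hx1
    -- Bernoulli for exponents in `[0, 1]`: `(1 - 1/x)^(1-b) ≤ 1 - (1-b)/x`, which makes the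
    -- increment of `x^(1-b)/(1-b)` at least `x^(-b)`.
    have hB := rpow_one_add_le_one_add_mul_self (s := -x⁻¹) (by linarith) h1.le
      (by linarith : 1 - b ≤ 1)
    have hKle : (K : ℝ) ^ (1 - b) ≤ x ^ (1 - b) - (1 - b) * x ^ (-b) := by
      rw [hK, Real.mul_rpow hx0.le (by linarith)]
      have hxb : x ^ (-b) = x ^ (1 - b) * x⁻¹ := by
        rw [← Real.rpow_neg_one x, ← Real.rpow_add hx0]; congr 1; ring
      rw [hxb]
      nlinarith [mul_le_mul_of_nonneg_left hB (Real.rpow_nonneg hx0.le (1 - b))]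
    have : (K : ℝ) ^ (1 - b) / (1 - b) ≤ x ^ (1 - b) / (1 - b) - x ^ (-b) := by
      rw [div_le_iff₀ h1, sub_mul, div_mul_cancel₀ _ h1.ne']
      linarith
    linarith

/-- Since `a ≤ 1` and `2b ≥ 1`, the numerator is at most the root of the denominator `N`, and `N ≥
1/K`. This crude bound on the confidence width pays for an arm's last active period. -/
theorem sqrt_sum_rpow_div_sum_le {b : ℝ} (hb : 1 / 2 ≤ b) {t : ℕ} {a : ℕ → ℝ} {K : ℝ} (hK : 0 < K)
    (ht : 1 ≤ t) (ha : ∀ s, K⁻¹ ≤ a s) (ha1 : ∀ s, a s ≤ 1) :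
    √(∑ s ∈ Finset.range t, a s ^ (2 * b)) / ∑ s ∈ Finset.range t, a s ≤ √K := by
  have ha0 : ∀ s, 0 < a s := fun s => (inv_pos.mpr hK).trans_le (ha s)
  have hN : K⁻¹ ≤ ∑ s ∈ Finset.range t, a s :=
    (ha 0).trans (Finset.single_le_sum (f := a) (fun s _ => (ha0 s).le) (Finset.mem_range.mpr ht))
  set N := ∑ s ∈ Finset.range t, a s
  have hN0 : 0 < N := (inv_pos.mpr hK).trans_le hN
  have hQ : ∑ s ∈ Finset.range t, a s ^ (2 * b) ≤ N := by
    refine Finset.sum_le_sum fun s _ => ?_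
    have := Real.rpow_le_rpow_of_exponent_ge (ha0 s) (ha1 s) (by linarith : 1 ≤ 2 * b)
    simpa using this
  rw [div_le_iff₀ hN0]
  calc √(∑ s ∈ Finset.range t, a s ^ (2 * b)) ≤ √(K * N ^ 2) := by
        refine Real.sqrt_le_sqrt (hQ.trans ?_)
        have : 1 ≤ K * N := by
          rw [inv_le_iff_one_le_mul₀ hK] at hN; linarith
        nlinarith
    _ = √K * N := by rw [Real.sqrt_mul hK.le, Real.sqrt_sq hN0.le]

/-- Cumulative regret of an elimination scheme with active sets `D 0 ⊇ D 1 ⊇ ⋯` that splits the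
resource evenly, when the gaps of the surviving arms are bounded by the confidence width. -/
theorem sum_avg_gap_le {K T : ℕ} (hK : 1 ≤ K) (hKT : K ≤ T) {D : ℕ → Finset (Fin K)}
    (hD : Antitone D) (hne : ∀ t, (D t).Nonempty) (h1 : D 1 = Finset.univ)
    {b : ℝ} (hb : 1 / 2 ≤ b) (hb1 : b < 1) {Δ : Fin K → ℝ} {G c : ℝ} (hΔ : ∀ i, 0 ≤ Δ i)
    (hG : ∀ i, Δ i ≤ G) (hc : 0 ≤ c)
    (hgap : ∀ t, 2 ≤ t → t < T → ∀ i ∈ D t,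
      Δ i ≤ c * (√(∑ s ∈ Finset.range t, ((D s).card : ℝ)⁻¹ ^ (2 * b)) /
        ∑ s ∈ Finset.range t, ((D s).card : ℝ)⁻¹)) :
    ∑ t ∈ Finset.range T, ∑ i ∈ D t, Δ i * ((D t).card : ℝ)⁻¹ ≤
      2 * G + 2 * c * √T * ((K : ℝ) ^ (1 - b) / (1 - b)) := by
  have h0 : D 0 = Finset.univ := by
    have := hD (Nat.zero_le 1)
    rw [h1] at this
    exact Finset.univ_subset_iff.mp this
  have hKpos : (0 : ℝ) < K := by exact_mod_cast hK
  have hcard1 : ∀ t, (1 : ℝ) ≤ (D t).card := fun t => by exact_mod_cast (hne t).card_pos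
  have hcard0 : ∀ t, (0 : ℝ) < (D t).card := fun t => one_pos.trans_le (hcard1 t)
  have hcardK : ∀ t, ((D t).card : ℝ) ≤ K := fun t => by
    exact_mod_cast (Finset.card_le_univ (D t)).trans_eq (Fintype.card_fin K)
  -- `τ i` is the last time before `T` at which arm `i` is active; the arm then still receives its
  -- share in period `τ i + 1`.
  have hex : ∀ i, ∃ τ, τ < T ∧ i ∈ D τ ∧ ∀ t < T, i ∈ D t → t ≤ τ := by
    intro i
    have hn : ((Finset.range T).filter fun t => i ∈ D t).Nonempty :=
      ⟨0, by simp [h0]; omega⟩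
    obtain ⟨τ, hτ, hmax⟩ := Finset.exists_max_image _ id hn
    simp only [Finset.mem_filter, Finset.mem_range, id] at hτ hmax
    exact ⟨τ, hτ.1, hτ.2, fun t ht hi => hmax t ⟨ht, hi⟩⟩
  choose τ hτT hτ hmax using hex
  have hswap : ∑ t ∈ Finset.range T, ∑ i ∈ D t, Δ i * ((D t).card : ℝ)⁻¹ =
      ∑ i, Δ i * ∑ t ∈ Finset.range (τ i + 1), ((D t).card : ℝ)⁻¹ := by
    simp_rw [Finset.mul_sum]
    refine Finset.sum_comm' fun t i => ?_
    simp only [Finset.mem_range, Finset.mem_univ, and_true, Nat.lt_succ_iff]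
    exact ⟨fun h => hmax i t h.1 h.2, fun h => ⟨h.trans_lt (hτT i), hD h (hτ i)⟩⟩
  have harm : ∀ i, Δ i * ∑ t ∈ Finset.range (τ i + 1), ((D t).card : ℝ)⁻¹ ≤
      2 * G / K + 2 * c * √T * ((D (τ i)).card : ℝ) ^ (-b) := by
    intro i
    have hG0 : 0 ≤ G := (hΔ i).trans (hG i)
    set k : ℝ := ((D (τ i)).card : ℝ) with hk
    have hk0 : 0 < k := hcard0 _
    have hk1 : 1 ≤ k := hcard1 _
    -- With `τ i < 2` no gap bound is available, but the arm takes part only in the first two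
    -- periods, at `1/K` each. Over all arms this costs `2 * G`.
    rcases Nat.lt_or_ge (τ i) 2 with hlt | hge
    · have hs : ∑ t ∈ Finset.range (τ i + 1), ((D t).card : ℝ)⁻¹ ≤ 2 / K := by
        calc _ ≤ ∑ t ∈ Finset.range 2, ((D t).card : ℝ)⁻¹ :=
              Finset.sum_le_sum_of_subset_of_nonneg
                (Finset.range_subset_range.mpr (by omega)) (fun t _ _ => (inv_pos.mpr (hcard0 t)).le)
          _ = 2 / K := by simp [Finset.sum_range_succ, h0, h1]; ring
      have : Δ i * ∑ t ∈ Finset.range (τ i + 1), ((D t).card : ℝ)⁻¹ ≤ G * (2 / K) :=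
        mul_le_mul (hG i) hs
          (Finset.sum_nonneg fun t _ => (inv_pos.mpr (hcard0 t)).le) hG0
      have h2 : 0 ≤ 2 * c * √T * k ^ (-b) := by positivity
      calc _ ≤ G * (2 / K) := this
        _ = 2 * G / K := by ring
        _ ≤ _ := by linarith
    · have hgi := hgap _ hge (hτT i) i (hτ i)
      have hR := sqrt_sum_rpow_div_sum_le (a := fun s => ((D s).card : ℝ)⁻¹) hb hKpos
        (by omega : 1 ≤ τ i) (fun s => inv_anti₀ (hcard0 s) (hcardK s))
        (fun s => inv_le_one_of_one_le₀ (hcard1 s))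
      rw [Finset.sum_range_succ, ← hk]
      set N := ∑ s ∈ Finset.range (τ i), ((D s).card : ℝ)⁻¹ with hN
      set Q := ∑ s ∈ Finset.range (τ i), ((D s).card : ℝ)⁻¹ ^ (2 * b) with hQ
      have hN0 : 0 < N := Finset.sum_pos (fun s _ => inv_pos.mpr (hcard0 s))
        ⟨0, Finset.mem_range.mpr (by omega)⟩
      -- Earlier active sets contain the one at time `τ i`, so each of the at most `T` allocations
      -- is at most `1/k`.
      have hQle : √Q ≤ √T * k ^ (-b) := by
        have hle : Q ≤ T * (k ^ (-b)) ^ 2 := by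
          have : ∀ s ∈ Finset.range (τ i), ((D s).card : ℝ)⁻¹ ^ (2 * b) ≤ (k ^ (-b)) ^ 2 := by
            intro s hs
            have hks : k ≤ (D s).card := by
              rw [hk]
              exact_mod_cast Finset.card_le_card (hD (Finset.mem_range.mp hs).le)
            have : (k ^ (-b)) ^ 2 = k⁻¹ ^ (2 * b) := by
              rw [Real.inv_rpow hk0.le, ← Real.rpow_neg hk0.le, ← Real.rpow_natCast,
                ← Real.rpow_mul hk0.le]
              congr 1; push_cast; ring
            rw [this]
            exact Real.rpow_le_rpow (inv_pos.mpr (hcard0 s)).le (inv_anti₀ hk0 hks) (by linarith)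
          calc Q ≤ (Finset.range (τ i)).card • (k ^ (-b)) ^ 2 := Finset.sum_le_card_nsmul _ _ _ this
            _ ≤ T * (k ^ (-b)) ^ 2 := by
              rw [Finset.card_range, nsmul_eq_mul]
              gcongr
              exact (hτT i).le
        calc √Q ≤ √(T * (k ^ (-b)) ^ 2) := Real.sqrt_le_sqrt hle
          _ = √T * k ^ (-b) := by
            rw [Real.sqrt_mul (Nat.cast_nonneg T), Real.sqrt_sq (Real.rpow_nonneg hk0.le _)]
      have hkb : k⁻¹ ≤ k ^ (-b) := by
        rw [← Real.rpow_neg_one]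
        exact Real.rpow_le_rpow_of_exponent_le hk1 (by linarith)
      have hKT' : √(K : ℝ) ≤ √T := Real.sqrt_le_sqrt (by exact_mod_cast hKT)
      have e1 : Δ i * N ≤ c * (√T * k ^ (-b)) := by
        calc Δ i * N ≤ c * (√Q / N) * N := by gcongr
          _ = c * √Q := by field_simp
          _ ≤ _ := by gcongr
      -- The final period `τ i + 1` is not part of `N`. Its cost uses the width bound `√K ≤ √T`,
      -- together with `1/k ≤ k^(-b)`.
      have e2 : Δ i * k⁻¹ ≤ c * (√T * k ^ (-b)) := by
        calc Δ i * k⁻¹ ≤ c * √T * k ^ (-b) := by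
              refine mul_le_mul (hgi.trans ?_) hkb (by positivity) (by positivity)
              exact mul_le_mul_of_nonneg_left (hR.trans hKT') hc
          _ = _ := by ring
      have : 0 ≤ 2 * G / K := by positivity
      rw [mul_add]
      linarith
  have hrank : ∑ i, ((D (τ i)).card : ℝ) ^ (-b) ≤
      ∑ m ∈ Finset.range K, ((m + 1 : ℕ) : ℝ) ^ (-b) := by
    refine sum_comp_rank_le (f := fun n : ℕ => (n : ℝ) ^ (-b)) ?_ (fun i => (D (τ i)).card) K
      Finset.univ (by simp) ?_
    · intro m n hm hmn
      exact Real.rpow_le_rpow_of_nonpos (by exact_mod_cast hm) (by exact_mod_cast hmn)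
        (by linarith)
    · intro S' _ hS'
      -- At the last active time of the first arm of `S'` to leave, all of `S'` is still active.
      obtain ⟨i, hi, hmin⟩ := Finset.exists_min_image S' τ hS'
      exact ⟨i, hi, Finset.card_le_card fun j hj => hD (hmin j hj) (hτ j)⟩
  rw [hswap]
  calc _ ≤ ∑ i, (2 * G / K + 2 * c * √T * ((D (τ i)).card : ℝ) ^ (-b)) :=
        Finset.sum_le_sum fun i _ => harm i
    _ = 2 * G + 2 * c * √T * ∑ i, ((D (τ i)).card : ℝ) ^ (-b) := by
      rw [Finset.sum_add_distrib, ← Finset.mul_sum]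
      simp only [Finset.sum_const, Finset.card_univ, Fintype.card_fin, nsmul_eq_mul]
      congr 1
      field_simp
    _ ≤ _ := by
      gcongr
      exact hrank.trans (sum_rpow_neg_le (by linarith) hb1 K)

/-! ### The algorithm on a fixed noise path -/

theorem length_play {K : ℕ} (b : ℝ) (μ : Fin K → ℝ) (π : Policy K) (x : ℕ → Fin K → ℝ) (t : ℕ) :
    (play b μ π x t).length = t := by
  induction t with
  | zero => rfl
  | succ t ih => simp [play, ih]

theorem sum_map_play {K : ℕ} (b : ℝ) (μ : Fin K → ℝ) (π : Policy K) (x : ℕ → Fin K → ℝ)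
    (f : Round K → ℝ) (t : ℕ) :
    ((play b μ π x t).map f).sum = ∑ s ∈ Finset.range t, f
      { alloc := π (play b μ π x s)
        reward := fun i =>
          π (play b μ π x s) i * μ i + π (play b μ π x s) i ^ b * x (s + 1) i } := by
  induction t with
  | zero => simp [play]
  | succ t ih => rw [Finset.sum_range_succ, ← ih]; simp [play, add_comm]

theorem play_congr {K : ℕ} (b : ℝ) (μ : Fin K → ℝ) (π : Policy K) {x y : ℕ → Fin K → ℝ} {t : ℕ}
    (h : ∀ s, 1 ≤ s → s ≤ t → x s = y s) : play b μ π x t = play b μ π y t := by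
  induction t with
  | zero => rfl
  | succ t ih =>
    have h1 := ih fun s hs hst => h s hs (hst.trans (Nat.le_succ t))
    simp only [play, h1, h (t + 1) (by omega) le_rfl]

namespace SuccElim

variable {K : ℕ} {b σ : ℝ} {T : ℕ} {μ : Fin K → ℝ}

theorem active_cons_subset (r : Round K) (h : History K) :
    active b σ T (r :: h) ⊆ active b σ T h := by
  rw [active]
  split_ifs
  · exact Finset.filter_subset _ _
  · exact subset_rfl

theorem mem_active_cons {r : Round K} {h : History K} (hh : h ≠ []) {i : Fin K} :
    i ∈ active b σ T (r :: h) ↔ i ∈ active b σ T h ∧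
      ∀ j ∈ active b σ T h, lcb b σ T (r :: h) j ≤ ucb b σ T (r :: h) i := by
  have : 2 ≤ (r :: h).length := by
    have := List.length_pos_iff.mpr hh
    simp only [List.length_cons]; omega
  rw [active, if_pos this, Finset.mem_filter]
  simp only [not_exists, not_and, not_lt]

theorem ci_nonneg (hσ : 0 ≤ σ) (h : History K) (i : Fin K) : 0 ≤ ci b σ T h i := by
  unfold ci; positivity

theorem lcb_le_ucb (hσ : 0 ≤ σ) (h : History K) (i : Fin K) : lcb b σ T h i ≤ ucb b σ T h i := by
  have := ci_nonneg (b := b) (T := T) hσ h i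
  unfold lcb ucb; linarith

theorem active_nonempty (hσ : 0 ≤ σ) (hK : 1 ≤ K) (h : History K) :
    (active b σ T h).Nonempty := by
  induction h with
  | nil => exact ⟨⟨0, hK⟩, Finset.mem_univ _⟩
  | cons r h ih =>
    rcases eq_or_ne h [] with rfl | hh
    · simpa [active] using ih
    · obtain ⟨i, hi, hmax⟩ := Finset.exists_max_image _ (ucb b σ T (r :: h)) ih
      exact ⟨i, (mem_active_cons hh).mpr ⟨hi, fun j hj => (lcb_le_ucb hσ _ j).trans (hmax j hj)⟩⟩

/-- The arms that are active after `t` periods on the noise path `x`. -/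
noncomputable def run (b σ : ℝ) (T : ℕ) (μ : Fin K → ℝ) (x : ℕ → Fin K → ℝ) (t : ℕ) :
    Finset (Fin K) :=
  active b σ T (play b μ (policy K b σ T) x t)

variable {x : ℕ → Fin K → ℝ}

theorem policy_play_of_mem {t : ℕ} {i : Fin K} (h : i ∈ run b σ T μ x t) :
    policy K b σ T (play b μ (policy K b σ T) x t) i = ((run b σ T μ x t).card : ℝ)⁻¹ := by
  rw [policy, ← run, if_pos h, one_div]

theorem antitone_run : Antitone (run b σ T μ x) :=
  antitone_nat_of_succ_le fun t => by
    rw [run, play]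
    exact active_cons_subset _ _

theorem run_one : run b σ T μ x 1 = Finset.univ := by
  simp [run, play, active]

theorem mem_run_succ {t : ℕ} (ht : 1 ≤ t) {i : Fin K} :
    i ∈ run b σ T μ x (t + 1) ↔ i ∈ run b σ T μ x t ∧ ∀ j ∈ run b σ T μ x t,
      lcb b σ T (play b μ (policy K b σ T) x (t + 1)) j ≤
        ucb b σ T (play b μ (policy K b σ T) x (t + 1)) i := by
  rw [run, play, mem_active_cons (List.ne_nil_of_length_pos (by rw [length_play]; omega))]
  rfl

/-- The resource received in the first `t` periods by an arm that is active throughout. -/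
noncomputable def share (b σ : ℝ) (T : ℕ) (μ : Fin K → ℝ) (x : ℕ → Fin K → ℝ) (t : ℕ) : ℝ :=
  ∑ s ∈ Finset.range t, ((run b σ T μ x s).card : ℝ)⁻¹

/-- The corresponding sum of the powers `2 b` of the allocations. -/
noncomputable def sqShare (b σ : ℝ) (T : ℕ) (μ : Fin K → ℝ) (x : ℕ → Fin K → ℝ) (t : ℕ) : ℝ :=
  ∑ s ∈ Finset.range t, ((run b σ T μ x s).card : ℝ)⁻¹ ^ (2 * b)

/-- The accumulated noise in the rewards of an arm that is active throughout. -/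
noncomputable def noise (b σ : ℝ) (T : ℕ) (μ : Fin K → ℝ) (x : ℕ → Fin K → ℝ) (t : ℕ)
    (i : Fin K) : ℝ :=
  ∑ s ∈ Finset.range t, ((run b σ T μ x s).card : ℝ)⁻¹ ^ b * x (s + 1) i

theorem policy_play_of_mem_of_lt {t s : ℕ} {i : Fin K} (h : i ∈ run b σ T μ x t) (hs : s < t + 1) :
    policy K b σ T (play b μ (policy K b σ T) x s) i = ((run b σ T μ x s).card : ℝ)⁻¹ :=
  policy_play_of_mem (antitone_run (Nat.lt_succ_iff.mp hs) h)

theorem share_pos (hσ : 0 ≤ σ) (hK : 1 ≤ K) (t : ℕ) : 0 < share b σ T μ x (t + 1) :=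
  Finset.sum_pos (fun _ _ => inv_pos.mpr (by exact_mod_cast (active_nonempty hσ hK _).card_pos))
    ⟨0, by simp⟩

theorem pulls_play {t : ℕ} {i : Fin K} (h : i ∈ run b σ T μ x t) :
    pulls (play b μ (policy K b σ T) x (t + 1)) i = share b σ T μ x (t + 1) := by
  rw [pulls, sum_map_play]
  exact Finset.sum_congr rfl fun s hs => policy_play_of_mem_of_lt h (Finset.mem_range.mp hs)

theorem meanEst_play (hσ : 0 ≤ σ) (hK : 1 ≤ K) {t : ℕ} {i : Fin K} (h : i ∈ run b σ T μ x t) :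
    meanEst (play b μ (policy K b σ T) x (t + 1)) i =
      μ i + noise b σ T μ x (t + 1) i / share b σ T μ x (t + 1) := by
  have hN := share_pos (b := b) (T := T) (μ := μ) (x := x) hσ hK t
  rw [meanEst, pulls_play h, sum_map_play, div_eq_iff hN.ne', add_mul,
    div_mul_cancel₀ _ hN.ne', share, noise, Finset.mul_sum, ← Finset.sum_add_distrib]
  refine Finset.sum_congr rfl fun s hs => ?_
  dsimp only
  rw [policy_play_of_mem_of_lt h (Finset.mem_range.mp hs), mul_comm (μ i)]

theorem ci_play (hσ : 0 ≤ σ) (hK : 1 ≤ K) {t : ℕ} {i : Fin K} (h : i ∈ run b σ T μ x t) :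
    ci b σ T (play b μ (policy K b σ T) x (t + 1)) i =
      2 * √3 * σ * √(Real.log (t + 1 : ℕ) * Real.log T) *
        (√(sqShare b σ T μ x (t + 1)) / share b σ T μ x (t + 1)) := by
  have hN := share_pos (b := b) (T := T) (μ := μ) (x := x) hσ hK t
  have hQ : ((play b μ (policy K b σ T) x (t + 1)).map fun r => r.alloc i ^ (2 * b)).sum =
      sqShare b σ T μ x (t + 1) := by
    rw [sum_map_play]
    exact Finset.sum_congr rfl fun s hs => by
      dsimp only
      rw [policy_play_of_mem_of_lt h (Finset.mem_range.mp hs)]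
  rw [ci, precision, pulls_play h, hQ, length_play, Real.sqrt_div (sq_nonneg _),
    Real.sqrt_sq hN.le]
  simp only [div_eq_mul_inv, mul_inv, inv_inv]
  ring

/-- As long as the estimates lie within their confidence widths, an optimal arm stays active, and
the gaps of the active arms are at most four confidence widths. -/
theorem gap_le_of_abs_noise_le (hσ : 0 ≤ σ) (hK : 1 ≤ K)
    (hgood : ∀ t, 1 ≤ t → t + 1 < T → ∀ i ∈ run b σ T μ x t, |noise b σ T μ x (t + 1) i| ≤
      2 * √3 * σ * √(Real.log (t + 1 : ℕ) * Real.log T) * √(sqShare b σ T μ x (t + 1)))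
    {j : Fin K} (hj : ∀ i, μ i ≤ μ j) (t : ℕ) (ht : 2 ≤ t) (htT : t < T) (i : Fin K)
    (hi : i ∈ run b σ T μ x t) :
    μ j - μ i ≤ 8 * √3 * σ * Real.log T * (√(sqShare b σ T μ x t) / share b σ T μ x t) := by
  have hest : ∀ t, 1 ≤ t → t + 1 < T → ∀ i ∈ run b σ T μ x t,
      |meanEst (play b μ (policy K b σ T) x (t + 1)) i - μ i| ≤
        ci b σ T (play b μ (policy K b σ T) x (t + 1)) i := by
    intro t ht htT i hi
    have hN := share_pos (b := b) (T := T) (μ := μ) (x := x) hσ hK t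
    rw [meanEst_play hσ hK hi, ci_play hσ hK hi, add_sub_cancel_left, abs_div, abs_of_pos hN,
      ← mul_div_assoc]
    exact div_le_div_of_nonneg_right (hgood t ht htT i hi) hN.le
  -- The lower bound of any active arm is at most its mean, which is at most `μ j`, which is at most
  -- the upper bound of `j`; hence `j` passes every test.
  have hbest : ∀ t < T, j ∈ run b σ T μ x t := by
    intro t
    induction t with
    | zero => exact fun _ => Finset.mem_univ _
    | succ t ih =>
      intro htT
      rcases Nat.eq_zero_or_pos t with rfl | ht
      · rw [zero_add, run_one]; exact Finset.mem_univ _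
      · have hjt := ih (by omega)
        refine (mem_run_succ ht).mpr ⟨hjt, fun i hi => ?_⟩
        have h1 := abs_le.mp (hest t ht htT i hi)
        have h2 := abs_le.mp (hest t ht htT j hjt)
        have := hj i
        unfold lcb ucb
        linarith [h1.2, h2.1]
  obtain ⟨t, rfl⟩ : ∃ u, t = u + 1 := ⟨t - 1, by omega⟩
  have ht1 : 1 ≤ t := by omega
  obtain ⟨hit, hle⟩ := (mem_run_succ ht1).mp hi
  have hjt := hbest t (by omega)
  have h1 := abs_le.mp (hest t ht1 htT i hit)
  have h2 := abs_le.mp (hest t ht1 htT j hjt)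
  have h3 := hle j hjt
  have hN := share_pos (b := b) (T := T) (μ := μ) (x := x) hσ hK t
  unfold lcb ucb at h3
  -- Arms active so far have received the same allocations, so the two widths coincide. Each arm
  -- contributes one width from its estimation error and one from the test.
  rw [ci_play hσ hK hit] at h1 h3
  rw [ci_play hσ hK hjt] at h2 h3
  have hlog : √(Real.log (t + 1 : ℕ) * Real.log T) ≤ Real.log T := by
    have hT : 0 ≤ Real.log T := Real.log_natCast_nonneg T
    have : Real.log (t + 1 : ℕ) ≤ Real.log T :=
      Real.log_le_log (by positivity) (by exact_mod_cast htT.le)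
    calc _ ≤ √(Real.log T * Real.log T) := Real.sqrt_le_sqrt (by gcongr)
      _ = Real.log T := Real.sqrt_mul_self hT
  calc μ j - μ i ≤ 4 * (2 * √3 * σ * √(Real.log (t + 1 : ℕ) * Real.log T) *
        (√(sqShare b σ T μ x (t + 1)) / share b σ T μ x (t + 1))) := by linarith [h1.2, h2.1]
    _ ≤ 4 * (2 * √3 * σ * Real.log T *
        (√(sqShare b σ T μ x (t + 1)) / share b σ T μ x (t + 1))) := by gcongr
    _ = _ := by ring

end SuccElim

/-! ### Exponential supermartingale and independence of the past -/

/-- One step of the exponential supermartingale: the next noise `Z` is independent of the past `X`,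
and the allocation `a` is a function of the past. -/
theorem lintegral_mul_exp_le {Ω E : Type*} [MeasurableSpace Ω] [MeasurableSpace E]
    {P : Measure Ω} [IsProbabilityMeasure P] {X : Ω → E} {Z : Ω → ℝ} {c : ℝ≥0}
    (hX : Measurable X) (hZ : Measurable Z) (hXZ : IndepFun X Z P) (hsub : HasSubgaussianMGF Z c P)
    {F : E → ENNReal} (hF : Measurable F) {a : E → ℝ} (ha : Measurable a) :
    ∫⁻ ω, F (X ω) * ENNReal.ofReal (Real.exp (a (X ω) * Z ω - c * a (X ω) ^ 2 / 2)) ∂P ≤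
      ∫⁻ ω, F (X ω) ∂P := by
  have hG : Measurable fun p : E × ℝ =>
      F p.1 * ENNReal.ofReal (Real.exp (a p.1 * p.2 - c * a p.1 ^ 2 / 2)) := by
    fun_prop
  -- With the allocation frozen at `r`, this is the sub-Gaussian bound; independence turns the joint
  -- law into a product, so Tonelli allows freezing.
  have hin : ∀ r : ℝ, ∫⁻ ω, ENNReal.ofReal (Real.exp (r * Z ω - c * r ^ 2 / 2)) ∂P ≤ 1 := by
    intro r
    have hint := hsub.integrable_exp_mul r
    have heq : ∀ ω, Real.exp (r * Z ω - c * r ^ 2 / 2) =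
        Real.exp (r * Z ω) * Real.exp (-(c * r ^ 2 / 2)) := fun ω => by
      rw [← Real.exp_add, sub_eq_add_neg]
    simp_rw [heq]
    rw [← ofReal_integral_eq_lintegral_ofReal (hint.mul_const _)
      (Filter.Eventually.of_forall fun ω => by positivity), integral_mul_const,
      ← ENNReal.ofReal_one]
    refine ENNReal.ofReal_le_ofReal ?_
    calc _ ≤ Real.exp (c * r ^ 2 / 2) * Real.exp (-(c * r ^ 2 / 2)) :=
          mul_le_mul_of_nonneg_right (hsub.mgf_le r) (Real.exp_pos _).le
      _ = 1 := by rw [← Real.exp_add]; simp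
  calc _ = ∫⁻ p, F p.1 * ENNReal.ofReal (Real.exp (a p.1 * p.2 - c * a p.1 ^ 2 / 2))
          ∂(P.map fun ω => (X ω, Z ω)) := by
        rw [lintegral_map hG (hX.prodMk hZ)]
    _ = ∫⁻ e, ∫⁻ z, F e * ENNReal.ofReal (Real.exp (a e * z - c * a e ^ 2 / 2))
          ∂(P.map Z) ∂(P.map X) := by
        rw [(indepFun_iff_map_prod_eq_prod_map_map hX.aemeasurable hZ.aemeasurable).mp hXZ]
        have := Measure.isProbabilityMeasure_map (μ := P) hZ.aemeasurable
        rw [lintegral_prod _ hG.aemeasurable]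
    _ ≤ ∫⁻ e, F e ∂(P.map X) := by
        refine lintegral_mono fun e => ?_
        rw [lintegral_const_mul _ (by fun_prop), lintegral_map (by fun_prop) hZ]
        exact mul_le_of_le_one_right zero_le (hin (a e))
    _ = ∫⁻ ω, F (X ω) ∂P := lintegral_map hF hX

/-- The noise path with all noises outside the periods `1, …, t` set to zero. -/
noncomputable def truncatedPath {Ω : Type*} {K : ℕ} (ξ : ℕ → Fin K → Ω → ℝ) (t : ℕ) (ω : Ω) :
    ℕ → Fin K → ℝ :=
  fun s i => if 1 ≤ s ∧ s ≤ t then ξ s i ω else 0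

theorem measurable_truncatedPath {Ω : Type*} [MeasurableSpace Ω] {K : ℕ}
    {ξ : ℕ → Fin K → Ω → ℝ} (hξ : ∀ s i, Measurable (ξ s i)) (t : ℕ) :
    Measurable (truncatedPath ξ t) := by
  refine measurable_pi_lambda _ fun s => measurable_pi_lambda _ fun i => ?_
  unfold truncatedPath
  split_ifs
  · exact hξ s i
  · exact measurable_const

/-- Independence is assumed only for the noises of periods `1, …, T`. The truncated path is a
measurable function of finitely many of these, none of them in period `t + 1`. -/
theorem indepFun_truncatedPath {Ω : Type*} [MeasurableSpace Ω] {P : Measure Ω}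
    {K T : ℕ} {ξ : ℕ → Fin K → Ω → ℝ}
    (hξ : ∀ s i, Measurable (ξ s i))
    (hind : iIndepFun (fun p : Finset.Icc 1 T × Fin K => ξ p.1 p.2) P) {t : ℕ} (ht : t < T)
    (i : Fin K) : IndepFun (truncatedPath ξ t) (ξ (t + 1) i) P := by
  classical
  let S : Finset (Finset.Icc 1 T × Fin K) := Finset.univ.filter fun p => (p.1 : ℕ) ≤ t
  let q : Finset.Icc 1 T × Fin K := (⟨t + 1, Finset.mem_Icc.mpr ⟨by omega, ht⟩⟩, i)
  have hdisj : Disjoint S {q} := by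
    simp [S, q]
  have h := hind.indepFun_finset S {q} hdisj fun p => hξ _ _
  let g : (S → ℝ) → ℕ → Fin K → ℝ := fun v s k =>
    if hs : 1 ≤ s ∧ s ≤ t then
      v ⟨(⟨s, Finset.mem_Icc.mpr ⟨hs.1, by omega⟩⟩, k), by simp [S, hs.2]⟩ else 0
  have hg : Measurable g := by
    refine measurable_pi_lambda _ fun s => measurable_pi_lambda _ fun k => ?_
    by_cases hs : 1 ≤ s ∧ s ≤ t
    · simp only [g, hs, and_self, dite_true]
      exact measurable_pi_apply _
    · simp only [g, hs, dite_false]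
      exact measurable_const
  have h' := h.comp hg (measurable_pi_apply (⟨q, Finset.mem_singleton_self q⟩ : ({q} : Finset _)))
  have hpast : truncatedPath ξ t = g ∘ fun ω (p : S) => ξ p.1.1 p.1.2 ω := by
    funext ω s k
    by_cases hs : 1 ≤ s ∧ s ≤ t <;> simp [truncatedPath, g, hs]
  rw [hpast]
  exact h'

/-! ### Measurability of the run and tail bound for a fixed tilt -/

namespace SuccElim

variable {K : ℕ} {b σ : ℝ} {T : ℕ} {μ : Fin K → ℝ}

/-- The confidence bounds after `t` periods involve only the allocations made at the times `s < t`.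
This is what closes the strong induction in `measurableSet_run`. -/
theorem measurable_bounds_of_measurable_policy {t : ℕ}
    (h : ∀ s < t, ∀ i, Measurable fun x => policy K b σ T (play b μ (policy K b σ T) x s) i)
    (i : Fin K) :
    Measurable (fun x => ucb b σ T (play b μ (policy K b σ T) x t) i) ∧
      Measurable (fun x => lcb b σ T (play b μ (policy K b σ T) x t) i) := by
  have hp : Measurable fun x => pulls (play b μ (policy K b σ T) x t) i := by
    simp only [pulls, sum_map_play]
    exact Finset.measurable_fun_sum _ fun s hs => h s (Finset.mem_range.mp hs) i
  have hm : Measurable fun x => meanEst (play b μ (policy K b σ T) x t) i := by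
    unfold meanEst
    refine Measurable.div ?_ hp
    simp only [sum_map_play]
    refine Finset.measurable_fun_sum _ fun s hs => ?_
    have hs := h s (Finset.mem_range.mp hs) i
    have hx : Measurable fun x : ℕ → Fin K → ℝ => x (s + 1) i := by fun_prop
    exact (hs.mul_const _).add ((hs.pow_const b).mul hx)
  have hc : Measurable fun x => ci b σ T (play b μ (policy K b σ T) x t) i := by
    unfold ci precision
    simp only [length_play]
    refine Measurable.div measurable_const (Measurable.sqrt ((hp.pow_const 2).div ?_))
    simp only [sum_map_play]
    exact Finset.measurable_fun_sum _ fun s hs => (h s (Finset.mem_range.mp hs) i).pow_const _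
  exact ⟨hm.add hc, hm.sub hc⟩

theorem measurable_policy_of_measurableSet_run {t : ℕ}
    (h : ∀ i, MeasurableSet {x | i ∈ run b σ T μ x t}) (i : Fin K) :
    Measurable fun x => policy K b σ T (play b μ (policy K b σ T) x t) i := by
  classical
  have hcard : Measurable fun x => ((run b σ T μ x t).card : ℝ) := by
    have : (fun x => ((run b σ T μ x t).card : ℝ)) =
        fun x => ∑ j, if j ∈ run b σ T μ x t then (1 : ℝ) else 0 := by
      funext x; simp
    rw [this]
    exact Finset.measurable_fun_sum _ fun j _ =>
      Measurable.ite (h j) measurable_const measurable_const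
  exact Measurable.ite (h i) (measurable_const.div hcard) measurable_const

theorem measurableSet_run (t : ℕ) : ∀ i, MeasurableSet {x | i ∈ run b σ T μ x t} := by
  induction t using Nat.strong_induction_on with
  | _ t ih =>
    intro i
    match t with
    | 0 => simp [run, play, active]
    | 1 => simp [run_one]
    | t + 2 =>
      have hb := measurable_bounds_of_measurable_policy (b := b) (σ := σ) (T := T) (μ := μ)
        fun s hs => measurable_policy_of_measurableSet_run (ih s hs)
      have heq : {x | i ∈ run b σ T μ x (t + 2)} = {x | i ∈ run b σ T μ x (t + 1)} ∩
          ⋂ j, ({x | j ∈ run b σ T μ x (t + 1)}ᶜ ∪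
            {x | lcb b σ T (play b μ (policy K b σ T) x (t + 2)) j ≤
              ucb b σ T (play b μ (policy K b σ T) x (t + 2)) i}) := by
        ext x
        simp only [Set.mem_ofPred_eq, mem_run_succ (Nat.le_add_left 1 t), Set.mem_inter_iff,
          Set.mem_iInter, Set.mem_union, Set.mem_compl_iff, imp_iff_not_or]
      rw [heq]
      exact (ih _ (by omega) i).inter (MeasurableSet.iInter fun j =>
        (ih _ (by omega) j).compl.union (measurableSet_le (hb j).2 (hb i).1))

theorem measurable_policy_play (t : ℕ) (i : Fin K) :
    Measurable fun x => policy K b σ T (play b μ (policy K b σ T) x t) i :=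
  measurable_policy_of_measurableSet_run (measurableSet_run t) i

/-- The logarithm of the exponential supermartingale with parameter `r` of arm `i`. -/
noncomputable def logMart (b σ : ℝ) (T : ℕ) (μ : Fin K → ℝ) (i : Fin K) (r : ℝ) (t : ℕ)
    (x : ℕ → Fin K → ℝ) : ℝ :=
  ∑ s ∈ Finset.range t,
    (r * policy K b σ T (play b μ (policy K b σ T) x s) i ^ b * x (s + 1) i -
      σ ^ 2 * (r * policy K b σ T (play b μ (policy K b σ T) x s) i ^ b) ^ 2 / 2)

theorem measurable_logMart (i : Fin K) (r : ℝ) (t : ℕ) :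
    Measurable (logMart b σ T μ i r t) := by
  unfold logMart
  refine Finset.measurable_fun_sum _ fun s _ => ?_
  have h := ((measurable_policy_play (b := b) (σ := σ) (T := T) (μ := μ) s i).pow_const b).const_mul
    r
  have hx : Measurable fun x : ℕ → Fin K → ℝ => x (s + 1) i := by fun_prop
  exact (h.mul hx).sub (((h.pow_const 2).const_mul _).div_const 2)

/-- The allocations through period `t + 1` depend only on the noises of the first `t` periods, so
they are functions of the truncated path. The new factor therefore has conditional mean at most one.
-/
theorem lintegral_exp_logMart_le_one {σ : ℝ≥0} {Ω : Type*} [MeasurableSpace Ω] {P : Measure Ω}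
    [IsProbabilityMeasure P] {ξ : ℕ → Fin K → Ω → ℝ} (hξ : ∀ s i, Measurable (ξ s i))
    (hind : iIndepFun (fun p : Finset.Icc 1 T × Fin K => ξ p.1 p.2) P)
    (hsub : ∀ t ∈ Finset.Icc 1 T, ∀ i, HasSubgaussianMGF (ξ t i) (σ ^ 2) P) (i : Fin K) (r : ℝ)
    (t : ℕ) (ht : t ≤ T) :
    ∫⁻ ω, ENNReal.ofReal (Real.exp (logMart b σ T μ i r t fun s k => ξ s k ω)) ∂P ≤ 1 := by
  induction t with
  | zero => simp [logMart]
  | succ t ih =>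
    refine le_trans ?_ (ih (by omega))
    have hplay : ∀ ω, ∀ s ≤ t, play b μ (policy K b σ T) (fun s k => ξ s k ω) s =
        play b μ (policy K b σ T) (truncatedPath ξ t ω) s := fun ω s hs =>
      play_congr _ _ _ fun s' h1 h2 => by
        funext k; simp [truncatedPath, h1, h2.trans hs]
    have hpast : ∀ ω, logMart b σ T μ i r t (fun s k => ξ s k ω) =
        logMart b σ T μ i r t (truncatedPath ξ t ω) := fun ω => by
      refine Finset.sum_congr rfl fun s hs => ?_
      have hs := Finset.mem_range.mp hs
      rw [hplay ω s hs.le]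
      simp [truncatedPath, Nat.succ_le_of_lt hs]
    have hF : Measurable fun x => ENNReal.ofReal (Real.exp (logMart b σ T μ i r t x)) :=
      (Real.measurable_exp.comp (measurable_logMart i r t)).ennreal_ofReal
    have key := lintegral_mul_exp_le (measurable_truncatedPath hξ t) (hξ (t + 1) i)
      (indepFun_truncatedPath hξ hind (by omega) i)
      (hsub (t + 1) (Finset.mem_Icc.mpr ⟨by omega, ht⟩) i) hF
      (((measurable_policy_play (b := b) (σ := σ) (T := T) (μ := μ) t i).pow_const b).const_mul r)
    refine le_of_eq_of_le ?_ (key.trans_eq ?_)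
    · refine lintegral_congr fun ω => ?_
      rw [← ENNReal.ofReal_mul (Real.exp_pos _).le, ← Real.exp_add, ← hpast ω, ← hplay ω t le_rfl,
        logMart, logMart, Finset.sum_range_succ, NNReal.coe_pow]
    · exact lintegral_congr fun ω => by rw [hpast ω]

/-- Markov's inequality at level `T^4 = exp (4 log T)`; the power 4 leaves room for a union over
`O(T^3)` events and for the factor `T` of the trivial regret. -/
theorem measure_le_logMart_le {σ : ℝ≥0} {Ω : Type*} [MeasurableSpace Ω] {P : Measure Ω}
    [IsProbabilityMeasure P] {ξ : ℕ → Fin K → Ω → ℝ} (hξ : ∀ s i, Measurable (ξ s i))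
    (hind : iIndepFun (fun p : Finset.Icc 1 T × Fin K => ξ p.1 p.2) P)
    (hsub : ∀ t ∈ Finset.Icc 1 T, ∀ i, HasSubgaussianMGF (ξ t i) (σ ^ 2) P) (i : Fin K) (r : ℝ)
    {t : ℕ} (ht : t ≤ T) (hT : 0 < T) :
    P.real {ω | 4 * Real.log T ≤ logMart b σ T μ i r t fun s k => ξ s k ω} ≤ ((T : ℝ) ^ 4)⁻¹ := by
  have hT0 : (0 : ℝ) < T := by exact_mod_cast hT
  have hpath : Measurable fun ω => fun s k => ξ s k ω :=
    measurable_pi_lambda _ fun s => measurable_pi_lambda _ fun k => hξ s k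
  have hm : Measurable fun ω =>
      ENNReal.ofReal (Real.exp (logMart b σ T μ i r t fun s k => ξ s k ω)) :=
    (Real.measurable_exp.comp ((measurable_logMart i r t).comp hpath)).ennreal_ofReal
  have h := (mul_meas_ge_le_lintegral (μ := P) hm (ENNReal.ofReal ((T : ℝ) ^ 4))).trans
    (lintegral_exp_logMart_le_one hξ hind hsub i r t ht)
  have hset : {ω | 4 * Real.log T ≤ logMart b σ T μ i r t fun s k => ξ s k ω} =
      {ω | ENNReal.ofReal ((T : ℝ) ^ 4) ≤
        ENNReal.ofReal (Real.exp (logMart b σ T μ i r t fun s k => ξ s k ω))} := by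
    ext ω
    rw [Set.mem_ofPred_eq, Set.mem_ofPred_eq, ENNReal.ofReal_le_ofReal_iff (Real.exp_pos _).le,
      ← Real.log_le_iff_le_exp (by positivity), Real.log_pow]
    norm_num
  rw [hset]
  have h' := ENNReal.toReal_mono ENNReal.one_ne_top h
  rw [ENNReal.toReal_mul, ENNReal.toReal_ofReal (by positivity), ENNReal.toReal_one] at h'
  rw [Measure.real, ← one_div, le_div_iff₀ (by positivity), mul_comm]
  exact h'

end SuccElim

/-! ### Grid of tilts and the bad event -/

/-- A geometric grid with ratio `7 / 5` approximates every point of `[√t / K, √t]` up to a relative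
error of `1 / 6`. -/
theorem exists_grid_point {K t : ℕ} {q : ℝ} (hq0 : 0 < q)
    (hq : √t ≤ K * q) (hqt : q ≤ √t) :
    ∃ m < 3 * K + 1, 5 / 6 * (√t * (5 / 7) ^ m * (6 / 7)) ≤ q ∧
      q ≤ 7 / 6 * (√t * (5 / 7) ^ m * (6 / 7)) := by
  -- With `v = √t (5/7)^m (6/7)`, the cell `[√t (5/7)^(m+1), √t (5/7)^m]` is exactly `[5/6 v, 7/6
  -- v]`.
  obtain ⟨m, h1, h2⟩ := exists_nat_pow_near ((one_le_div hq0).mpr hqt)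
    (by norm_num : (1 : ℝ) < 7 / 5)
  have hpow : ((7 : ℝ) / 5) ^ m * (5 / 7) ^ m = 1 := by rw [← mul_pow]; norm_num
  have hp5 : (0 : ℝ) < (5 / 7) ^ m := by positivity
  rw [le_div_iff₀ hq0] at h1
  rw [div_lt_iff₀ hq0, pow_succ] at h2
  refine ⟨m, ?_, ?_, ?_⟩
  -- Bernoulli: `1 + 2m/5 ≤ (7/5)^m ≤ K`, so linearly many grid points in `K` are enough.
  · have hB := one_add_mul_le_pow (by norm_num : (-2 : ℝ) ≤ 2 / 5) m
    have : ((7 : ℝ) / 5) ^ m ≤ K := le_of_mul_le_mul_right (h1.trans hq) hq0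
    norm_num at hB
    have hm : (m : ℝ) < (3 * K + 1 : ℕ) := by
      push_cast
      linarith
    exact_mod_cast hm
  · calc 5 / 6 * (√t * (5 / 7) ^ m * (6 / 7))
        ≤ 5 / 6 * ((7 / 5) ^ m * (7 / 5) * q * (5 / 7) ^ m * (6 / 7)) := by gcongr
      _ = ((7 / 5) ^ m * (5 / 7) ^ m) * q := by ring
      _ = q := by rw [hpow, one_mul]
  · calc q = ((7 / 5) ^ m * q) * (5 / 7) ^ m := by
          rw [mul_right_comm, hpow, one_mul]
      _ ≤ √t * (5 / 7) ^ m := by gcongr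
      _ = _ := by ring

/-- The tilt `w / (σ v)` would be optimal for `q = v`, with exponent `w²/2`. When `u = q / v` is
only near 1, the exponent is still at least `w² (u - u²/2)`. -/
theorem le_tilt_of_lt {t T : ℕ} {σ v q M : ℝ} (ht : 2 ≤ t) (hσ : 0 < σ) (hv : 0 < v)
    (h1 : 5 / 6 * v ≤ q) (h2 : q ≤ 7 / 6 * v)
    (hM : 2 * √3 * σ * √(Real.log t * Real.log T) * q < M) :
    4 * Real.log T ≤ 2 * √3 * √(Real.log t * Real.log T) / (σ * v) * M -
      σ ^ 2 * (2 * √3 * √(Real.log t * Real.log T) / (σ * v)) ^ 2 / 2 * q ^ 2 := by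
  have hT : 0 ≤ Real.log T := Real.log_natCast_nonneg T
  have ht0 : 0.6931 ≤ Real.log t := by
    have : Real.log 2 ≤ Real.log t := Real.log_le_log (by norm_num) (by exact_mod_cast ht)
    linarith [Real.log_two_gt_d9]
  have hL : 0 ≤ Real.log t * Real.log T := by positivity
  set w := 2 * √3 * √(Real.log t * Real.log T) with hw
  have hw0 : 0 ≤ w := by positivity
  have hw2 : w ^ 2 = 12 * (Real.log t * Real.log T) := by
    rw [hw, mul_pow, mul_pow, Real.sq_sqrt hL, Real.sq_sqrt (by norm_num)]; ring
  set u := q / v with hu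
  have hq : q = u * v := by rw [hu]; field_simp
  have hu1 : 5 / 6 ≤ u := by rw [hu, le_div_iff₀ hv]; exact h1
  have hu2 : u ≤ 7 / 6 := by rw [hu, div_le_iff₀ hv]; exact h2
  have hlam : 0 ≤ w / (σ * v) := by positivity
  have hM' : 2 * √3 * σ * √(Real.log t * Real.log T) * q = w * σ * q := by rw [hw]; ring
  rw [hM'] at hM
  -- On `[5/6, 7/6]` the minimum of `u - u²/2` is `35/72`, attained at both endpoints. Since `t ≥
  -- 2`, `12 · 35/72 · log t ≥ (35/6) log 2 > 4`; this is where the factor `2 √3` of the width is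
  -- used.
  calc 4 * Real.log T ≤ 12 * (Real.log t * Real.log T) * (35 / 72) := by nlinarith
    _ ≤ w ^ 2 * (u - u ^ 2 / 2) := by
      rw [hw2]
      refine mul_le_mul_of_nonneg_left ?_ (by positivity)
      nlinarith
    _ = w / (σ * v) * (w * σ * q) - σ ^ 2 * (w / (σ * v)) ^ 2 / 2 * q ^ 2 := by
      rw [hq]; field_simp
    _ ≤ _ := by
      have := mul_le_mul_of_nonneg_left hM.le hlam
      linarith

namespace SuccElim

variable {K : ℕ} {b σ : ℝ} {T : ℕ} {μ : Fin K → ℝ} {x : ℕ → Fin K → ℝ}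

/-- The supermartingale uses the true allocations, so that it continues after the arm is eliminated;
only while the arm is active does it reduce to the common shares. -/
theorem logMart_eq {t : ℕ} {i : Fin K} (hi : i ∈ run b σ T μ x t) (r : ℝ) :
    logMart b σ T μ i r (t + 1) x = r * noise b σ T μ x (t + 1) i -
      σ ^ 2 * r ^ 2 / 2 * sqShare b σ T μ x (t + 1) := by
  rw [logMart, noise, sqShare, Finset.mul_sum, Finset.mul_sum, ← Finset.sum_sub_distrib]
  refine Finset.sum_congr rfl fun s hs => ?_
  rw [policy_play_of_mem_of_lt hi (Finset.mem_range.mp hs)]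
  have h0 : (0 : ℝ) ≤ ((run b σ T μ x s).card : ℝ)⁻¹ := by positivity
  have : ((run b σ T μ x s).card : ℝ)⁻¹ ^ (2 * b) = (((run b σ T μ x s).card : ℝ)⁻¹ ^ b) ^ 2 := by
    rw [mul_comm, Real.rpow_mul h0, Real.rpow_two]
  rw [this]
  ring

/-- Allocations to active arms lie in `[1/K, 1]` and `2b ≤ 2`, so each summand lies in `[1/K², 1]`.
This deterministic range makes a finite grid possible. -/
theorem sqrt_sqShare_bounds (hσ : 0 ≤ σ) (hK : 1 ≤ K) (hb : 0 ≤ b) (hb1 : b ≤ 1) {t : ℕ}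
    (ht : 1 ≤ t) :
    0 < √(sqShare b σ T μ x t) ∧ √t ≤ K * √(sqShare b σ T μ x t) ∧
      √(sqShare b σ T μ x t) ≤ √t := by
  have hK0 : (0 : ℝ) < K := by exact_mod_cast hK
  have hc1 : ∀ s, (1 : ℝ) ≤ (run b σ T μ x s).card := fun s => by
    exact_mod_cast (active_nonempty hσ hK _).card_pos
  have hcK : ∀ s, ((run b σ T μ x s).card : ℝ) ≤ K := fun s => by
    exact_mod_cast (Finset.card_le_univ _).trans_eq (Fintype.card_fin K)
  have hpos : ∀ s, (0 : ℝ) < (run b σ T μ x s).card := fun s => one_pos.trans_le (hc1 s)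
  have hle : sqShare b σ T μ x t ≤ t := by
    calc sqShare b σ T μ x t ≤ ∑ s ∈ Finset.range t, (1 : ℝ) :=
          Finset.sum_le_sum fun s _ => Real.rpow_le_one (inv_pos.mpr (hpos s)).le
            (inv_le_one_of_one_le₀ (hc1 s)) (by linarith)
      _ = t := by simp
  have hge : t * ((K : ℝ)⁻¹) ^ 2 ≤ sqShare b σ T μ x t := by
    calc t * ((K : ℝ)⁻¹) ^ 2 = ∑ s ∈ Finset.range t, ((K : ℝ)⁻¹) ^ 2 := by simp
      _ ≤ sqShare b σ T μ x t := Finset.sum_le_sum fun s _ => by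
        calc ((K : ℝ)⁻¹) ^ 2 ≤ ((run b σ T μ x s).card : ℝ)⁻¹ ^ 2 := by
              gcongr
              · exact hpos s
              · exact_mod_cast hcK s
          _ = ((run b σ T μ x s).card : ℝ)⁻¹ ^ (2 : ℝ) := (Real.rpow_two _).symm
          _ ≤ _ := Real.rpow_le_rpow_of_exponent_ge (inv_pos.mpr (hpos s))
            (inv_le_one_of_one_le₀ (hc1 s)) (by linarith)
  have ht0 : (0 : ℝ) < t := by exact_mod_cast ht
  refine ⟨Real.sqrt_pos.mpr (lt_of_lt_of_le (by positivity) hge), ?_, Real.sqrt_le_sqrt hle⟩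
  have := Real.sqrt_le_sqrt hge
  rw [Real.sqrt_mul ht0.le, Real.sqrt_sq (by positivity), ← div_eq_mul_inv,
    div_le_iff₀ hK0] at this
  linarith

/-- The tilting parameters for period `t` at the grid point `m`. -/
noncomputable def tilt (σ : ℝ) (T t m : ℕ) : ℝ :=
  2 * √3 * √(Real.log t * Real.log T) / (σ * (√t * (5 / 7) ^ m * (6 / 7)))

/-- The noise paths on which one of the exponential supermartingales is large. -/
def badPaths (b σ : ℝ) (T : ℕ) (μ : Fin K → ℝ) : Set (ℕ → Fin K → ℝ) :=
  ⋃ p ∈ Finset.range T ×ˢ (Finset.univ : Finset (Fin K)) ×ˢ Finset.range (3 * K + 1) ×ˢ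
    ({1, -1} : Finset ℤ), {x | 4 * Real.log T ≤ logMart b σ T μ p.2.1
      (p.2.2.2 * tilt σ T p.1 p.2.2.1) p.1 x}

theorem measurableSet_badPaths : MeasurableSet (badPaths b σ T μ) :=
  Finset.measurableSet_biUnion _ fun _ _ =>
    measurableSet_le measurable_const (measurable_logMart _ _ _)

theorem mem_badPaths {t m : ℕ} {i : Fin K} {e : ℤ} (ht : t < T) (hm : m < 3 * K + 1)
    (he : e = 1 ∨ e = -1) (h : 4 * Real.log T ≤ logMart b σ T μ i (e * tilt σ T t m) t x) :
    x ∈ badPaths b σ T μ := by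
  rw [badPaths, Set.mem_iUnion₂]
  exact ⟨(t, i, m, e), by simp [ht, hm, he], h⟩

/-- If the noise were too large, the grid point next to the random `√Q` would provide a tilt, fixed
in advance, whose supermartingale exceeds its threshold; the sign of the tilt is that of the noise.
-/
theorem abs_noise_le (hσ : 0 < σ) (hK : 1 ≤ K) (hb : 0 ≤ b) (hb1 : b ≤ 1)
    (hx : x ∉ badPaths b σ T μ) {t : ℕ} (ht : 1 ≤ t) (htT : t + 1 < T) {i : Fin K}
    (hi : i ∈ run b σ T μ x t) :
    |noise b σ T μ x (t + 1) i| ≤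
      2 * √3 * σ * √(Real.log (t + 1 : ℕ) * Real.log T) * √(sqShare b σ T μ x (t + 1)) := by
  by_contra! hlt
  refine hx ?_
  obtain ⟨hq0, hq1, hq2⟩ := sqrt_sqShare_bounds (T := T) (μ := μ) (x := x) hσ.le hK hb hb1
    (Nat.le_add_left 1 t)
  obtain ⟨m, hm, h1, h2⟩ := exists_grid_point hq0 hq1 hq2
  have hv : 0 < √((t + 1 : ℕ) : ℝ) * (5 / 7) ^ m * (6 / 7) := by positivity
  have key := le_tilt_of_lt (by omega) hσ hv h1 h2 hlt
  rw [Real.sq_sqrt (Real.sqrt_pos.mp hq0).le, ← tilt] at key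
  rcases abs_choice (noise b σ T μ x (t + 1) i) with h | h <;> rw [h] at key
  · refine mem_badPaths (i := i) (e := 1) htT hm (Or.inl rfl) ?_
    rw [logMart_eq hi]
    push_cast
    linarith
  · refine mem_badPaths (i := i) (e := -1) htT hm (Or.inr rfl) ?_
    rw [logMart_eq hi]
    push_cast
    linarith

/-- Union bound: `K ≤ T` gives at most `T · T · 4T · 2` events, each of probability at most
`T^(-4)`. -/
theorem mul_measure_badPaths_le {σ : ℝ≥0} {Ω : Type*} [MeasurableSpace Ω] {P : Measure Ω}
    [IsProbabilityMeasure P] {ξ : ℕ → Fin K → Ω → ℝ} (hξ : ∀ s i, Measurable (ξ s i))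
    (hind : iIndepFun (fun p : Finset.Icc 1 T × Fin K => ξ p.1 p.2) P)
    (hsub : ∀ t ∈ Finset.Icc 1 T, ∀ i, HasSubgaussianMGF (ξ t i) (σ ^ 2) P)
    (hK : 1 ≤ K) (hKT : K ≤ T) :
    T * P.real {ω | (fun s k => ξ s k ω) ∈ badPaths b σ T μ} ≤ 8 := by
  have hT : 1 ≤ T := hK.trans hKT
  set I := Finset.range T ×ˢ (Finset.univ : Finset (Fin K)) ×ˢ Finset.range (3 * K + 1) ×ˢ
    ({1, -1} : Finset ℤ) with hI
  have hset : {ω | (fun s k => ξ s k ω) ∈ badPaths b σ T μ} =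
      ⋃ p ∈ I, {ω | 4 * Real.log T ≤ logMart b σ T μ p.2.1
        (p.2.2.2 * tilt σ T p.1 p.2.2.1) p.1 fun s k => ξ s k ω} := by
    ext ω
    simp only [badPaths, Set.mem_ofPred_eq, Set.mem_iUnion, hI]
  have hcard : I.card ≤ 8 * T ^ 3 := by
    have h1 : I.card = T * (K * ((3 * K + 1) * 2)) := by
      simp [hI]
    rw [h1]
    calc T * (K * ((3 * K + 1) * 2)) ≤ T * (T * ((3 * T + T) * 2)) := by gcongr
      _ = 8 * T ^ 3 := by ring
  have hT0 : (0 : ℝ) < T := by exact_mod_cast hT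
  have hP : P.real {ω | (fun s k => ξ s k ω) ∈ badPaths b σ T μ} ≤
      I.card * ((T : ℝ) ^ 4)⁻¹ := by
    rw [hset]
    refine (measureReal_biUnion_finset_le _ _).trans ?_
    rw [← nsmul_eq_mul]
    refine Finset.sum_le_card_nsmul _ _ _ fun p hp => ?_
    have hpT : p.1 < T := by
      simp only [hI, Finset.mem_product, Finset.mem_range] at hp
      exact hp.1
    exact measure_le_logMart_le hξ hind hsub _ _ hpT.le hT
  calc T * P.real {ω | (fun s k => ξ s k ω) ∈ badPaths b σ T μ}
      ≤ T * ((8 * T ^ 3 : ℕ) * ((T : ℝ) ^ 4)⁻¹) := by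
        gcongr
        refine hP.trans ?_
        gcongr
    _ = 8 := by push_cast; field_simp

/-! ### From good paths to expected regret -/

/-- The regret of period `t + 1` on the noise path `x`. -/
noncomputable def stepRegret (b σ : ℝ) (T : ℕ) (μ : Fin K → ℝ) (x : ℕ → Fin K → ℝ) (t : ℕ) : ℝ :=
  (⨆ j, μ j) - ∑ i, policy K b σ T (play b μ (policy K b σ T) x t) i * μ i

theorem stepRegret_eq (hσ : 0 ≤ σ) (hK : 1 ≤ K) (t : ℕ) :
    stepRegret b σ T μ x t = ∑ i ∈ run b σ T μ x t,
      ((⨆ j, μ j) - μ i) * ((run b σ T μ x t).card : ℝ)⁻¹ := by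
  classical
  have hc : ((run b σ T μ x t).card : ℝ) ≠ 0 := by
    exact_mod_cast (active_nonempty hσ hK _).card_ne_zero
  have h1 : ∑ i, policy K b σ T (play b μ (policy K b σ T) x t) i * μ i =
      ∑ i ∈ run b σ T μ x t, ((run b σ T μ x t).card : ℝ)⁻¹ * μ i := by
    rw [← Finset.sum_subset (Finset.subset_univ (run b σ T μ x t))]
    · exact Finset.sum_congr rfl fun i hi => by rw [policy_play_of_mem hi]
    · intro i _ hi
      rw [policy, ← run, if_neg hi, zero_mul]
  rw [stepRegret, h1, ← Finset.sum_mul, Finset.sum_sub_distrib, sub_mul, ← Finset.mul_sum]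
  simp [hc, mul_comm]

theorem sub_le_gapMax (i : Fin K) : (⨆ j, μ j) - μ i ≤ gapMax μ :=
  le_ciSup (f := fun i => (⨆ j, μ j) - μ i) (Set.finite_range _).bddAbove i

theorem sub_iSup_nonneg (i : Fin K) : 0 ≤ (⨆ j, μ j) - μ i :=
  sub_nonneg.mpr (le_ciSup (Set.finite_range μ).bddAbove i)

theorem stepRegret_nonneg (hσ : 0 ≤ σ) (hK : 1 ≤ K) (t : ℕ) : 0 ≤ stepRegret b σ T μ x t := by
  rw [stepRegret_eq hσ hK]
  exact Finset.sum_nonneg fun i _ => mul_nonneg (sub_iSup_nonneg i) (by positivity)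

theorem stepRegret_le (hσ : 0 ≤ σ) (hK : 1 ≤ K) (t : ℕ) :
    stepRegret b σ T μ x t ≤ gapMax μ := by
  have hc : ((run b σ T μ x t).card : ℝ) ≠ 0 := by
    exact_mod_cast (active_nonempty hσ hK _).card_ne_zero
  rw [stepRegret_eq hσ hK, ← Finset.sum_mul, ← div_eq_mul_inv, div_le_iff₀ (by positivity)]
  calc _ ≤ (run b σ T μ x t).card • gapMax μ :=
        Finset.sum_le_card_nsmul _ _ _ fun i _ => sub_le_gapMax i
    _ = _ := by rw [nsmul_eq_mul, mul_comm]

theorem sum_stepRegret_le (hσ : 0 < σ) (hK : 1 ≤ K) (hKT : K ≤ T) (hb : 1 / 2 ≤ b) (hb1 : b < 1)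
    (hx : x ∉ badPaths b σ T μ) :
    ∑ t ∈ Finset.range T, stepRegret b σ T μ x t ≤
      2 * gapMax μ + 2 * (8 * √3 * σ * Real.log T) * √T * ((K : ℝ) ^ (1 - b) / (1 - b)) := by
  have : Nonempty (Fin K) := ⟨⟨0, hK⟩⟩
  obtain ⟨j, hj⟩ := exists_eq_ciSup_of_finite (f := μ)
  simp_rw [stepRegret_eq hσ.le hK]
  refine sum_avg_gap_le hK hKT antitone_run (fun t => active_nonempty hσ.le hK _) run_one hb hb1
    sub_iSup_nonneg sub_le_gapMax
    (mul_nonneg (by positivity) (Real.log_natCast_nonneg T)) fun t ht htT i hi => ?_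
  rw [← hj]
  exact gap_le_of_abs_noise_le hσ.le hK
    (fun t ht htT i hi => abs_noise_le hσ hK (by linarith) hb1.le hx ht htT hi)
    (fun i => hj ▸ le_ciSup (Set.finite_range μ).bddAbove i) t ht htT i hi

/-- Of the factor 10, 2 comes from the initial periods on good paths, and 8 from the trivial bound
`T * gapMax μ` on bad paths. -/
theorem regret_le_of_measurable {σ : ℝ≥0} {Ω : Type*} [MeasurableSpace Ω] {P : Measure Ω}
    [IsProbabilityMeasure P] {ξ : ℕ → Fin K → Ω → ℝ} (hξ : ∀ s i, Measurable (ξ s i))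
    (hind : iIndepFun (fun p : Finset.Icc 1 T × Fin K => ξ p.1 p.2) P)
    (hsub : ∀ t ∈ Finset.Icc 1 T, ∀ i, HasSubgaussianMGF (ξ t i) (σ ^ 2) P)
    (hσ : 0 < σ) (hK : 1 ≤ K) (hKT : K ≤ T) (hb : 1 / 2 ≤ b) (hb1 : b < 1) :
    regret P b μ ξ (policy K b σ T) T ≤
      10 * gapMax μ + 2 * (8 * √3 * σ * Real.log T) * √T * ((K : ℝ) ^ (1 - b) / (1 - b)) := by
  have hσ0 : (0 : ℝ) < σ := hσ
  have hG : 0 ≤ gapMax μ := (sub_iSup_nonneg ⟨0, hK⟩).trans (sub_le_gapMax ⟨0, hK⟩)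
  set B := 2 * gapMax μ + 2 * (8 * √3 * σ * Real.log T) * √T * ((K : ℝ) ^ (1 - b) / (1 - b))
    with hB
  have hB0 : 0 ≤ B := by
    have := Real.log_natCast_nonneg T
    have : 0 < 1 - b := by linarith
    positivity
  have hpath : Measurable fun ω => fun s k => ξ s k ω :=
    measurable_pi_lambda _ fun s => measurable_pi_lambda _ fun k => hξ s k
  set bad := {ω | (fun s k => ξ s k ω) ∈ badPaths b σ T μ} with hbad
  have hbadm : MeasurableSet bad := hpath measurableSet_badPaths
  have hmeas : ∀ t, Measurable fun ω => stepRegret b σ T μ (fun s k => ξ s k ω) t := by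
    intro t
    refine Measurable.comp (g := fun x => stepRegret b σ T μ x t) ?_ hpath
    exact measurable_const.sub (Finset.measurable_fun_sum _ fun i _ =>
      (measurable_policy_play t i).mul_const _)
  have hint : ∀ t, Integrable (fun ω => stepRegret b σ T μ (fun s k => ξ s k ω) t) P := fun t =>
    Integrable.of_bound (hmeas t).aestronglyMeasurable (gapMax μ)
      (Filter.Eventually.of_forall fun ω => by
        rw [Real.norm_of_nonneg (stepRegret_nonneg hσ0.le hK t)]
        exact stepRegret_le hσ0.le hK t)
  have hpt : ∀ ω, ∑ t ∈ Finset.range T, stepRegret b σ T μ (fun s k => ξ s k ω) t ≤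
      B + bad.indicator (fun _ => T * gapMax μ) ω := by
    intro ω
    by_cases hω : ω ∈ bad
    · rw [Set.indicator_of_mem hω]
      have := Finset.sum_le_card_nsmul (Finset.range T)
        (fun t => stepRegret b σ T μ (fun s k => ξ s k ω) t) (gapMax μ)
        fun t _ => stepRegret_le hσ0.le hK t
      rw [Finset.card_range, nsmul_eq_mul] at this
      linarith
    · rw [Set.indicator_of_notMem hω, add_zero]
      exact sum_stepRegret_le hσ0 hK hKT hb hb1 hω
  have hintI : Integrable (bad.indicator fun _ => T * gapMax μ) P :=
    (integrable_const _).indicator hbadm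
  calc regret P b μ ξ (policy K b σ T) T
      = ∫ ω, ∑ t ∈ Finset.range T, stepRegret b σ T μ (fun s k => ξ s k ω) t ∂P :=
        (integral_finsetSum _ fun t _ => hint t).symm
    _ ≤ ∫ ω, (B + bad.indicator (fun _ => T * gapMax μ) ω) ∂P :=
        integral_mono (integrable_finsetSum _ fun t _ => hint t)
          ((integrable_const _).add hintI) hpt
    _ = B + T * P.real bad * gapMax μ := by
        rw [integral_add (integrable_const _) hintI, integral_indicator_const _ hbadm]
        simp only [integral_const, probReal_univ, smul_eq_mul, one_mul]
        ring
    _ ≤ B + 8 * gapMax μ := by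
        gcongr
        exact mul_measure_badPaths_le hξ hind hsub hK hKT
    _ = _ := by rw [hB]; ring

end SuccElim

/-- Only noises of periods `1, …, T` enter the play, so changing them on null sets, and the others
arbitrarily, leaves the regret unchanged. -/
theorem regret_congr_ae {K : ℕ} {Ω : Type*} [MeasurableSpace Ω] {P : Measure Ω} {b : ℝ}
    {μ : Fin K → ℝ} {ξ η : ℕ → Fin K → Ω → ℝ} {π : Policy K} {T : ℕ}
    (h : ∀ t ∈ Finset.Icc 1 T, ∀ i, ξ t i =ᵐ[P] η t i) :
    regret P b μ ξ π T = regret P b μ η π T := by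
  have hall : ∀ᵐ ω ∂P, ∀ t ∈ Finset.Icc 1 T, ∀ i, ξ t i ω = η t i ω :=
    (Filter.eventually_all_finset _).mpr fun t ht => Filter.eventually_all.mpr (h t ht)
  refine Finset.sum_congr rfl fun t ht => integral_congr_ae ?_
  filter_upwards [hall] with ω hω
  have ht := Finset.mem_range.mp ht
  rw [play_congr b μ π fun s hs hst => funext (hω s (Finset.mem_Icc.mpr ⟨hs, by omega⟩))]

theorem theorem2 (b : ℝ) (hb : 1 / 2 ≤ b) (hb1 : b < 1) :
    ∃ C : ℝ, 0 < C ∧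
      ∀ (K T : ℕ), 1 ≤ K → K ≤ T →
      ∀ (σ : ℝ≥0), 0 < σ →
      ∀ (μ : Fin K → ℝ), (∀ i, 0 ≤ μ i) →
      ∀ (Ω : Type*) [MeasurableSpace Ω] (P : Measure Ω) [IsProbabilityMeasure P]
        (ξ : ℕ → Fin K → Ω → ℝ),
        iIndepFun (fun p : Finset.Icc 1 T × Fin K => ξ p.1 p.2) P →
        (∀ t ∈ Finset.Icc 1 T, ∀ i, HasSubgaussianMGF (ξ t i) (σ ^ 2) P) →
        regret P b μ ξ (SuccElim.policy K b σ T) T ≤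
          C * (gapMax μ + σ * (K : ℝ) ^ (1 - b) * √(T : ℝ) * Real.log T) := by
  have hb' : 0 < 1 - b := by linarith
  refine ⟨10 + 16 * √3 / (1 - b), by positivity, ?_⟩
  intro K T hK hKT σ hσ μ _ Ω _ P _ ξ hind hsub
  classical
  -- The sub-Gaussian hypothesis gives only a.e.-measurability, and only in periods `1, …, T`;
  -- measurable versions are taken there and zero elsewhere.
  let η : ℕ → Fin K → Ω → ℝ := fun t i =>
    if h : t ∈ Finset.Icc 1 T then (hsub t h i).aemeasurable.mk (ξ t i) else 0
  have hη : ∀ t i, Measurable (η t i) := by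
    intro t i
    by_cases h : t ∈ Finset.Icc 1 T
    · simp only [η, h, dite_true]
      exact AEMeasurable.measurable_mk _
    · simp only [η, h, dite_false]
      exact measurable_const
  have hae : ∀ t ∈ Finset.Icc 1 T, ∀ i, ξ t i =ᵐ[P] η t i := by
    intro t h i
    simp only [η, h, dite_true]
    exact AEMeasurable.ae_eq_mk _
  have hmain := SuccElim.regret_le_of_measurable (μ := μ) hη
    (hind.congr fun p => hae p.1 p.1.2 p.2)
    (fun t ht i => (hsub t ht i).congr (hae t ht i)) hσ hK hKT hb hb1
  rw [regret_congr_ae hae]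
  refine hmain.trans ?_
  have hG : 0 ≤ gapMax μ :=
    (SuccElim.sub_iSup_nonneg ⟨0, hK⟩).trans (SuccElim.sub_le_gapMax ⟨0, hK⟩)
  have hlog := Real.log_natCast_nonneg T
  have h1 : 0 ≤ 16 * √3 / (1 - b) * gapMax μ := by positivity
  have h2 : 0 ≤ 10 * (σ * (K : ℝ) ^ (1 - b) * √(T : ℝ) * Real.log T) := by positivity
  have h3 : 2 * (8 * √3 * σ * Real.log T) * √T * ((K : ℝ) ^ (1 - b) / (1 - b)) =
      16 * √3 / (1 - b) * (σ * (K : ℝ) ^ (1 - b) * √(T : ℝ) * Real.log T) := by ring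
  rw [h3, add_mul, mul_add, mul_add]
  linarith
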